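/- Let $\Gamma_{\rm mon}(\ell^2(\mathbb Z))$ be the monotone Fock space over $\ell^2(\mathbb Z)$, i.e. the Hilbert space with orthonormal basis $e_{i_1}\otimes\cdots\otimes e_{i_n}$, $i_1<\cdots<i_n$ in $\mathbb Z$, $n\ge 0$ (for $n=0$ this is the vacuum vector). For $i\in\mathbb Z$ the monotone creator $m_i^\dagger$ sends $e_{i_1}\otimes\cdots\otimes e_{i_n}$ to $e_i\otimes e_{i_1}\otimes\cdots\otimes e_{i_n}$ if $n=0$ or $i<i_1$, and to $0$ otherwise. Let $\mathfrak M$ be the C*-algebra generated by the identity $I$ and $\{m_i^\dagger\mid i\in\mathbb Z\}$, and let $s$ be the one-step shift, i.e. the unital $*$-homomorphism $s:\mathfrak M\to\mathfrak M$ with $s(m_i^\dagger)=m_{i+1}^\dagger$; it is implemented by the unitary $e_{i_1}\otimes\cdots\otimes e_{i_n}\mapsto e_{i_1+1}\otimes\cdots\otimes e_{i_n+1}$. For an $s$-invariant state $\varphi$ of $\mathfrak M$ with GNS representation $(\mathcal H_\varphi,\pi_\varphi,\xi_\varphi)$, let $V_{\varphi,s}$ be the isometry of $\mathcal H_\varphi$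 with $V_{\varphi,s}\pi_\varphi(a)\xi_\varphi=\pi_\varphi(s(a))\xi_\varphi$ for $a\in\mathfrak M$. The full peripheral pure-point spectrum $\sigma^{(\rm ph,f)}_{\rm pp}(s)$ is the set of all $\lambda$ in the unit circle $\mathbb T$ that are eigenvalues of $V_{\varphi,s}$ for some $s$-invariant state $\varphi$. The system $(\mathfrak M,s)$ is uniquely ergodic with respect to the fixed-point subalgebra $\mathfrak M^s=\{a\in\mathfrak M\mid s(a)=a\}$ if every state of $\mathfrak M^s$ has exactly one $s$-invariant extension to a state of $\mathfrak M$. Then: 1. for every $\lambda\in\mathbb T\smallsetminus\{1\}$ and every $x\in\mathfrak M$, $\displaystyle\lim_{n\to+\infty}\frac1n\sum_{k=0}^{n-1}\lambda^{-k}s^k(x)=0$ in norm; 2. $\sigma^{(\rm ph,f)}_{\rm pp}(s)=\{1\}$; 3. $(\mathfrak M,s)$ is not uniquely ergodic with respect to $\mathfrak M^s$; moreover there is an $x\in\mathfrak M$ for which the averages $\frac1n\sum_{k=0}^{n-1}s^k(x)$ do not converge in norm. -/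

import Mathlib

open Filter Topology
open scoped ComplexOrder ENNReal

noncomputable section

/-! ### Operators on `ℓ²` induced by partial bijections of the index sets -/

/-- The Hilbert space `ℓ²(α)`. -/
abbrev EllTwo (α : Type*) : Type _ := lp (fun _ : α => ℂ) 2

/-- The coordinate expression of the partial isometry induced by a partial bijection `f`:
the coordinate at `b` of the image of `ψ` is the coordinate of `ψ` at the preimage of `b`,
and `0` if `b` has no preimage. -/
def pullCoord {α β : Type*} (f : α ≃. β) (ψ : α → ℂ) (b : β) : ℂ :=
  (f.symm b).elim 0 ψ

theorem pullCoord_sq_sum_le {α β : Type*} (f : α ≃. β) (ψ : EllTwo α) (s : Finset β) :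
    ∑ b ∈ s, ‖pullCoord f ψ b‖ ^ (2 : ℝ≥0∞).toReal ≤ ‖ψ‖ ^ (2 : ℝ≥0∞).toReal := by
  classical
  have h0 : ∀ b ∈ s, b ∉ s.filter (fun b => (f.symm b).isSome) →
      ‖pullCoord f ψ b‖ ^ (2 : ℝ≥0∞).toReal = 0 := by
    intro b hb hb'
    have hn : f.symm b = none := by
      by_contra hne
      exact hb' (Finset.mem_filter.2 ⟨hb, Option.isSome_iff_ne_none.2 hne⟩)
    simp [pullCoord, hn]
  rw [← Finset.sum_subset (Finset.filter_subset _ s) h0]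
  have hsome : ∀ b ∈ s.filter (fun b => (f.symm b).isSome), (f.symm b).isSome := fun b hb =>
    (Finset.mem_filter.1 hb).2
  rw [← Finset.sum_attach]
  have hinj : Function.Injective
      (fun b : {b // b ∈ s.filter (fun b => (f.symm b).isSome)} =>
        (f.symm b.1).get (hsome b.1 b.2)) := by
    intro b c hbc
    have hb := Option.some_get (hsome b.1 b.2)
    have hc := Option.some_get (hsome c.1 c.2)
    simp only at hbc
    rw [hbc] at hb
    have h1 := (f.eq_some_iff).1 hb.symm
    have h2 := (f.eq_some_iff).1 hc.symm
    rw [h1] at h2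
    exact Subtype.ext (Option.some.inj h2)
  have hrw : ∀ b : {b // b ∈ s.filter (fun b => (f.symm b).isSome)},
      pullCoord f ψ b.1 = ψ ((f.symm b.1).get (hsome b.1 b.2)) := by
    intro b
    have hb := Option.some_get (hsome b.1 b.2)
    simp only [pullCoord]
    conv_lhs => rw [← hb]
    rfl
  simp only [hrw]
  have := lp.sum_rpow_le_norm_rpow (p := 2) (by norm_num) ψ
    ((s.filter (fun b => (f.symm b).isSome)).attach.map ⟨_, hinj⟩)
  rwa [Finset.sum_map] at this

/-- The partial isometry `ℓ²(α) → ℓ²(β)` induced by a partial bijection `f`: it sends the basis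
vector `e_a` to `e_{f a}` if `f` is defined at `a`, and to `0` otherwise. -/
def partialIsometry {α β : Type*} (f : α ≃. β) : EllTwo α →L[ℂ] EllTwo β :=
  LinearMap.mkContinuous
    { toFun := fun ψ => ⟨pullCoord f ψ, memℓp_gen' (pullCoord_sq_sum_le f ψ)⟩
      map_add' := fun ψ χ => by
        ext b
        change (f.symm b).elim 0 (⇑ψ + ⇑χ) = (f.symm b).elim 0 ⇑ψ + (f.symm b).elim 0 ⇑χ
        cases f.symm b <;> simp
      map_smul' := fun c ψ => by
        ext b
        change pullCoord f _ b = c * pullCoord f _ b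
        unfold pullCoord
        cases f.symm b <;> simp } 1
    (fun ψ => by
      rw [one_mul]
      exact lp.norm_le_of_forall_sum_le (by norm_num) (norm_nonneg _)
        (pullCoord_sq_sum_le f ψ))

theorem partialIsometry_apply {α β : Type*} (f : α ≃. β) (ψ : EllTwo α) (b : β) :
    partialIsometry f ψ b = (f.symm b).elim 0 ψ := rfl

theorem partialIsometry_refl (α : Type*) : partialIsometry (PEquiv.refl α) = 1 := by
  ext ψ a
  rfl

theorem partialIsometry_trans {α β γ : Type*} (f : α ≃. β) (g : β ≃. γ) :
    partialIsometry (f.trans g) = partialIsometry g ∘L partialIsometry f := by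
  ext ψ c
  have h : (f.trans g).symm c = (g.symm c).bind f.symm := rfl
  simp only [partialIsometry_apply, ContinuousLinearMap.comp_apply, h]
  cases g.symm c <;> rfl

theorem partialIsometry_single_some {α β : Type*} [DecidableEq α] [DecidableEq β] (f : α ≃. β)
    {a : α} {b : β} (h : f a = some b) :
    partialIsometry f (lp.single 2 a (1 : ℂ)) = lp.single 2 b (1 : ℂ) := by
  ext c
  rw [partialIsometry_apply]
  cases hc : f.symm c with
  | none =>
    have : c ≠ b := by
      rintro rfl
      rw [f.eq_some_iff.2 h] at hc
      exact absurd hc (by simp)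
    simp [lp.single_apply, this]
  | some a' =>
    have hc' := f.eq_some_iff.1 hc
    by_cases haa : a' = a
    · subst haa
      rw [h] at hc'
      cases Option.some.inj hc'
      simp
    · have : c ≠ b := by
        rintro rfl
        rw [f.eq_some_iff.2 h] at hc
        exact haa (Option.some.inj hc).symm
      simp [lp.single_apply, this, haa]

theorem partialIsometry_single_none {α β : Type*} [DecidableEq α] (f : α ≃. β)
    {a : α} (h : f a = none) :
    partialIsometry f (lp.single 2 a (1 : ℂ)) = 0 := by
  ext c
  rw [partialIsometry_apply]
  cases hc : f.symm c with
  | none => simp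
  | some a' =>
    have hc' := f.eq_some_iff.1 hc
    have : a' ≠ a := by
      rintro rfl
      rw [h] at hc'
      exact absurd hc' (by simp)
    simp [lp.single_apply, this]

theorem adjoint_partialIsometry {α β : Type*} (f : α ≃. β) :
    ContinuousLinearMap.adjoint (partialIsometry f) = partialIsometry f.symm := by
  classical
  ext χ a
  have h1 := lp.inner_single_left (𝕜 := ℂ) a (1 : ℂ)
    (ContinuousLinearMap.adjoint (partialIsometry f) χ)
  rw [ContinuousLinearMap.adjoint_inner_right] at h1
  rw [partialIsometry_apply, PEquiv.symm_symm]
  cases hf : f a with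
  | none =>
    rw [partialIsometry_single_none f hf] at h1
    simpa using h1.symm
  | some b =>
    rw [partialIsometry_single_some f hf, lp.inner_single_left] at h1
    simpa using h1.symm

/-! ### The monotone Fock space, the monotone creators and the shift -/

/-- Finite strictly increasing sequences `i₁ < ⋯ < iₙ` of integers, `n ≥ 0`. -/
abbrev IncSeq : Type := {t : List ℤ // t.Pairwise (· < ·)}

/-- The empty sequence. -/
def IncSeq.empty : IncSeq := ⟨[], List.Pairwise.nil⟩

/-- The monotone Fock space over `ℓ²(ℤ)`: the Hilbert space with orthonormal basis
`e_{i₁} ⊗ ⋯ ⊗ e_{iₙ}`, `i₁ < ⋯ < iₙ`, `n ≥ 0`. -/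
abbrev MonotoneFock : Type := EllTwo IncSeq

/-- The basis vector `e_{i₁} ⊗ ⋯ ⊗ e_{iₙ}`. -/
def fockBasis (t : IncSeq) : MonotoneFock := lp.single 2 t (1 : ℂ)

/-- The vacuum vector. -/
def vacuum : MonotoneFock := fockBasis IncSeq.empty

/-- The partial bijection `(i₁, …, iₙ) ↦ (i, i₁, …, iₙ)`, defined when the right-hand side is
strictly increasing. -/
def prependIndex (i : ℤ) : IncSeq ≃. IncSeq where
  toFun t := if h : (i :: t.1).Pairwise (· < ·) then some ⟨i :: t.1, h⟩ else none
  invFun t :=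
    match t with
    | ⟨[], _⟩ => none
    | ⟨j :: l, h⟩ => if j = i then some ⟨l, h.of_cons⟩ else none
  inv := by
    rintro ⟨a, ha⟩ ⟨b, hb⟩
    cases b with
    | nil => simp
    | cons j l =>
      by_cases hji : j = i
      · subst hji
        simp only [↓reduceIte, Option.some.injEq, Subtype.mk.injEq, Option.dite_none_right_eq_some,
          List.cons.injEq, true_and, exists_prop]
        constructor
        · rintro rfl
          exact ⟨hb, rfl⟩
        · rintro ⟨-, h⟩
          exact h.symm
      · simp [hji, Ne.symm hji]

/-- The monotone creator `m†ᵢ`: it sends `e_{i₁} ⊗ ⋯ ⊗ e_{iₙ}` to `eᵢ ⊗ e_{i₁} ⊗ ⋯ ⊗ e_{iₙ}` if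
`i < i₁` (or `n = 0`) and to `0` otherwise. -/
def creator (i : ℤ) : MonotoneFock →L[ℂ] MonotoneFock := partialIsometry (prependIndex i)

theorem creator_fockBasis_of_lt (i : ℤ) (t : IncSeq) (h : (i :: t.1).Pairwise (· < ·)) :
    creator i (fockBasis t) = fockBasis ⟨i :: t.1, h⟩ :=
  partialIsometry_single_some _ (by
    change (if h : (i :: t.1).Pairwise (· < ·) then some (⟨i :: t.1, h⟩ : IncSeq) else none) = _
    rw [dif_pos h])

theorem creator_fockBasis_of_not_lt (i : ℤ) (t : IncSeq) (h : ¬ (i :: t.1).Pairwise (· < ·)) :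
    creator i (fockBasis t) = 0 :=
  partialIsometry_single_none _ (by
    change (if h : (i :: t.1).Pairwise (· < ·) then some (⟨i :: t.1, h⟩ : IncSeq) else none) = _
    rw [dif_neg h])

/-- The bijection `(i₁, …, iₙ) ↦ (i₁ + c, …, iₙ + c)`. -/
def shiftIndex (c : ℤ) : IncSeq ≃. IncSeq where
  toFun t := some ⟨t.1.map (· + c), t.2.map _ (fun _ _ h => by simpa using h)⟩
  invFun t := some ⟨t.1.map (· + -c), t.2.map _ (fun _ _ h => by simpa using h)⟩
  inv := by
    rintro ⟨a, ha⟩ ⟨b, hb⟩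
    simp only [Option.some.injEq, Subtype.mk.injEq]
    constructor
    · rintro rfl
      simp [List.map_map, Function.comp_def]
    · rintro rfl
      simp [List.map_map, Function.comp_def]

theorem shiftIndex_symm (c : ℤ) : (shiftIndex c).symm = shiftIndex (-c) := by
  ext t : 1
  rfl

theorem shiftIndex_trans_neg (c : ℤ) :
    (shiftIndex c).trans (shiftIndex (-c)) = PEquiv.refl IncSeq := by
  ext t : 1
  change some _ = some _
  congr 1
  apply Subtype.ext
  simp [List.map_map, Function.comp_def]

/-- The unitary on the monotone Fock space obtained by monotone second quantisation of the shift
`e_j ↦ e_{j+1}` of `ℓ²(ℤ)`; it fixes the vacuum and sends `e_{i₁} ⊗ ⋯ ⊗ e_{iₙ}` to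
`e_{i₁+1} ⊗ ⋯ ⊗ e_{iₙ+1}`. -/
def fockShift : unitary (MonotoneFock →L[ℂ] MonotoneFock) :=
  ⟨partialIsometry (shiftIndex 1), by
    have h1 : (shiftIndex (-1)).trans (shiftIndex 1) = PEquiv.refl IncSeq := by
      simpa using shiftIndex_trans_neg (-1)
    rw [Unitary.mem_iff, ContinuousLinearMap.star_eq_adjoint, adjoint_partialIsometry,
      shiftIndex_symm]
    constructor
    · rw [ContinuousLinearMap.mul_def, ← partialIsometry_trans, shiftIndex_trans_neg,
        partialIsometry_refl]
    · rw [ContinuousLinearMap.mul_def, ← partialIsometry_trans, h1, partialIsometry_refl]⟩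

theorem fockShift_creator (i : ℤ) :
    Unitary.conjStarAlgAut ℂ (MonotoneFock →L[ℂ] MonotoneFock) fockShift (creator i) =
      creator (i + 1) := by
  rw [Unitary.conjStarAlgAut_apply]
  change partialIsometry (shiftIndex 1) * partialIsometry (prependIndex i) *
    star (partialIsometry (shiftIndex 1)) = partialIsometry (prependIndex (i + 1))
  rw [ContinuousLinearMap.star_eq_adjoint, adjoint_partialIsometry, shiftIndex_symm,
    ContinuousLinearMap.mul_def, ContinuousLinearMap.mul_def, ← partialIsometry_trans,
    ← partialIsometry_trans]
  congr 1
  ext ⟨t, ht⟩ : 1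
  have hP : (i :: t.map (· + -1)).Pairwise (· < ·) ↔ ((i + 1) :: t).Pairwise (· < ·) := by
    simp only [List.pairwise_cons, List.mem_map, List.pairwise_map, forall_exists_index, and_imp,
      forall_apply_eq_imp_iff₂, add_lt_add_iff_right]
    refine and_congr_left fun _ => forall₂_congr fun a _ => ?_
    omega
  change (if h : (i :: t.map (· + -1)).Pairwise (· < ·) then
      some (⟨i :: t.map (· + -1), h⟩ : IncSeq) else none).bind (shiftIndex 1) =
    (if h : ((i + 1) :: t).Pairwise (· < ·) then some (⟨(i + 1) :: t, h⟩ : IncSeq) else none)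
  by_cases h : ((i + 1) :: t).Pairwise (· < ·)
  · rw [dif_pos h, dif_pos (hP.2 h)]
    change some _ = some _
    congr 1
    apply Subtype.ext
    simp [List.map_map, Function.comp_def]
  · rw [dif_neg h, dif_neg (fun h' => h (hP.1 h'))]
    rfl

/-- The concrete unital C⋆-algebra generated by the identity and the monotone creators. -/
def monotoneAlgebra : StarSubalgebra ℂ (MonotoneFock →L[ℂ] MonotoneFock) :=
  (StarAlgebra.adjoin ℂ (Set.range creator)).topologicalClosure

instance monotoneAlgebra_isClosed :
    IsClosed (monotoneAlgebra : Set (MonotoneFock →L[ℂ] MonotoneFock)) :=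
  StarSubalgebra.isClosed_topologicalClosure _

theorem creator_mem (i : ℤ) : creator i ∈ monotoneAlgebra :=
  StarSubalgebra.le_topologicalClosure _ (StarAlgebra.subset_adjoin ℂ _ ⟨i, rfl⟩)

theorem conj_fockShift_mem (x : MonotoneFock →L[ℂ] MonotoneFock) (hx : x ∈ monotoneAlgebra) :
    Unitary.conjStarAlgAut ℂ (MonotoneFock →L[ℂ] MonotoneFock) fockShift x ∈ monotoneAlgebra := by
  let F : (MonotoneFock →L[ℂ] MonotoneFock) →⋆ₐ[ℂ] (MonotoneFock →L[ℂ] MonotoneFock) :=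
    (Unitary.conjStarAlgAut ℂ (MonotoneFock →L[ℂ] MonotoneFock) fockShift :
      (MonotoneFock →L[ℂ] MonotoneFock) ≃⋆ₐ[ℂ] (MonotoneFock →L[ℂ] MonotoneFock))
  have hF : Continuous F := by
    change Continuous fun x : MonotoneFock →L[ℂ] MonotoneFock =>
      (fockShift : MonotoneFock →L[ℂ] MonotoneFock) * x * (star fockShift : _)
    fun_prop
  have hle : monotoneAlgebra ≤ monotoneAlgebra.comap F := by
    refine StarSubalgebra.topologicalClosure_minimal ?_
      (monotoneAlgebra_isClosed.preimage hF)
    refine StarAlgebra.adjoin_le ?_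
    rintro _ ⟨i, rfl⟩
    change Unitary.conjStarAlgAut ℂ _ fockShift (creator i) ∈ monotoneAlgebra
    rw [fockShift_creator]
    exact creator_mem _
  exact hle hx

/-- The one-step shift on the monotone C⋆-algebra, implemented by `fockShift`. -/
def monotoneShift : monotoneAlgebra →⋆ₐ[ℂ] monotoneAlgebra :=
  StarAlgHom.codRestrict
    (((Unitary.conjStarAlgAut ℂ (MonotoneFock →L[ℂ] MonotoneFock) fockShift :
      (MonotoneFock →L[ℂ] MonotoneFock) ≃⋆ₐ[ℂ] (MonotoneFock →L[ℂ] MonotoneFock)) :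
      (MonotoneFock →L[ℂ] MonotoneFock) →⋆ₐ[ℂ] (MonotoneFock →L[ℂ] MonotoneFock)).comp
      monotoneAlgebra.subtype)
    monotoneAlgebra (fun x => conj_fockShift_mem x.1 x.2)

/-- The shift acts on generators as `m†ᵢ ↦ m†ᵢ₊₁`. -/
theorem monotoneShift_creator (i : ℤ) :
    monotoneShift ⟨creator i, creator_mem i⟩ = ⟨creator (i + 1), creator_mem (i + 1)⟩ :=
  Subtype.ext (fockShift_creator i)

/-! ### States, covariant GNS representations and spectra of C⋆-dynamical systems -/

/-- A state of a unital ⋆-algebra: a linear functional that is positive (on the elements `a⋆ a`)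
and takes the value `1` at the identity. -/
structure AlgState (A : Type*) [Ring A] [StarRing A] [Algebra ℂ A] where
  /-- the underlying functional -/
  toLinearMap : A →ₗ[ℂ] ℂ
  nonneg : ∀ a : A, 0 ≤ toLinearMap (star a * a)
  map_one : toLinearMap 1 = 1

section CovariantGNS

variable {A : Type*} [CStarAlgebra A]

/-- The state `φ` is invariant under `Φ`. -/
def AlgState.IsInvariant (φ : AlgState A) (Φ : A →⋆ₐ[ℂ] A) : Prop :=
  ∀ a : A, φ.toLinearMap (Φ a) = φ.toLinearMap a

attribute [local instance] CStarAlgebra.spectralOrder CStarAlgebra.spectralOrderedRing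

/-- A state as a positive linear functional for the order of the C⋆-algebra `A`. -/
def AlgState.toPositive (φ : AlgState A) : A →ₚ[ℂ] ℂ :=
  PositiveLinearMap.mk₀ φ.toLinearMap (fun x hx => by
    obtain ⟨b, rfl⟩ := CStarAlgebra.nonneg_iff_eq_star_mul_self.1 hx
    exact φ.nonneg b)

/-- The GNS Hilbert space of the state `φ`. -/
abbrev AlgState.GNSSpace (φ : AlgState A) : Type _ := φ.toPositive.GNS

/-- The map `π_φ(a) ξ_φ ↦ π_φ(Φ(a)) ξ_φ` before completion. -/
def preCovariant (φ : AlgState A) (Φ : A →⋆ₐ[ℂ] A) (h : φ.IsInvariant Φ) :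
    φ.toPositive.PreGNS →L[ℂ] φ.toPositive.PreGNS :=
  LinearMap.mkContinuous
    (φ.toPositive.toPreGNS.toLinearMap ∘ₗ Φ.toAlgHom.toLinearMap ∘ₗ
      φ.toPositive.ofPreGNS.toLinearMap) 1
    (fun a => by
      rw [one_mul, PositiveLinearMap.preGNS_norm_def, PositiveLinearMap.preGNS_norm_def]
      apply le_of_eq
      congr 2
      change φ.toLinearMap (star (Φ (φ.toPositive.ofPreGNS a)) * Φ (φ.toPositive.ofPreGNS a)) =
        φ.toLinearMap (star (φ.toPositive.ofPreGNS a) * φ.toPositive.ofPreGNS a)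
      rw [← map_star, ← map_mul]
      exact h _)

/-- The isometry `V_{φ,Φ}` of the covariant GNS representation of an invariant state `φ`:
`V_{φ,Φ} π_φ(a) ξ_φ = π_φ(Φ(a)) ξ_φ`. -/
def covariantIsometry (φ : AlgState A) (Φ : A →⋆ₐ[ℂ] A) (h : φ.IsInvariant Φ) :
    φ.GNSSpace →L[ℂ] φ.GNSSpace :=
  (preCovariant φ Φ h).completion

/-- The class `π_φ(a) ξ_φ` of `a` in the GNS space. -/
def gnsClass (φ : AlgState A) (a : A) : φ.GNSSpace :=
  ((φ.toPositive.toPreGNS a : φ.toPositive.PreGNS) : φ.GNSSpace)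

theorem covariantIsometry_gnsClass (φ : AlgState A) (Φ : A →⋆ₐ[ℂ] A) (h : φ.IsInvariant Φ)
    (a : A) : covariantIsometry φ Φ h (gnsClass φ a) = gnsClass φ (Φ a) := by
  simp only [covariantIsometry, gnsClass]
  rw [ContinuousLinearMap.completion_apply_coe]
  rfl

theorem inner_gnsClass (φ : AlgState A) (a b : A) :
    inner ℂ (gnsClass φ a) (gnsClass φ b) = φ.toLinearMap (star a * b) := by
  simp only [gnsClass]
  rw [UniformSpace.Completion.inner_coe]
  rfl

/-- The full peripheral pure-point spectrum of `(A, Φ)`: the set of the eigenvalues of modulus one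
of the isometries `V_{φ,Φ}`, where `φ` ranges over all the invariant states. -/
def fullPeripheralPointSpectrum (Φ : A →⋆ₐ[ℂ] A) : Set ℂ :=
  {z : ℂ | ‖z‖ = 1 ∧ ∃ (φ : AlgState A) (h : φ.IsInvariant Φ),
    Module.End.HasEigenvalue
      ((covariantIsometry φ Φ h : φ.GNSSpace →ₗ[ℂ] φ.GNSSpace) : Module.End ℂ φ.GNSSpace) z}

/-- The fixed-point subalgebra `A^Φ = {a | Φ a = a}`. -/
def fixedPointSubalgebra (Φ : A →⋆ₐ[ℂ] A) : StarSubalgebra ℂ A :=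
  StarAlgHom.equalizer Φ (StarAlgHom.id ℂ A)

/-- `(A, Φ)` is uniquely ergodic with respect to its fixed-point subalgebra: every state of the
fixed-point subalgebra has exactly one extension to a `Φ`-invariant state of `A`. -/
def UniquelyErgodicWrtFixedPoints (Φ : A →⋆ₐ[ℂ] A) : Prop :=
  ∀ ψ : AlgState (fixedPointSubalgebra Φ), ∃! φ : AlgState A,
    φ.IsInvariant Φ ∧ ∀ a : fixedPointSubalgebra Φ, φ.toLinearMap (a : A) = ψ.toLinearMap a

/-- The weighted ergodic average `n⁻¹ ∑_{k<n} z⁻ᵏ Φᵏ(a)`. -/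
def ergodicAverage (Φ : A →⋆ₐ[ℂ] A) (z : ℂ) (n : ℕ) (a : A) : A :=
  (n : ℂ)⁻¹ • ∑ k ∈ Finset.range n, (z ^ k)⁻¹ • (Φ^[k]) a

end CovariantGNS

end

/-! Write `P i = star (creator i) * creator i`, the projection onto the basis vectors whose indices
all exceed `i`. Reducing words shows that the linear span of `1`, the `P i`, the products `creator i
* y` and the products `y * star (creator i)` is dense. Since the averages are contractions,
convergence to `0` needs checking on these four families only.

On `1` the average is a bounded geometric sum divided by `n`. The shifts of `creator i * y` have
pairwise orthogonal ranges, so by the C⋆-identity their averages are `O(n^(-1/2))` for every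
unimodular weight; adjoints cover `y * star (creator i)`. Finally `P i - P (i + 1) = creator (i + 1)
* star (creator (i + 1))` and the shift sends `P i` to `P (i + 1)`. Hence `(1 - z) • P i` is a
twisted coboundary, whose averages telescope, plus an element of the orthogonal type. Only `1` and
the `P i` need `z ≠ 1`.

In a covariant GNS space the same averages tend to `0` on a dense set, hence everywhere, but they
fix any eigenvector for `z`; so `z ≠ 1` is impossible, while the cyclic vector gives the eigenvalue
`1`.

The vector states of `e_n` have two shift-invariant limits, the vacuum state as `n → +∞` and another
state as `n → -∞`. They agree on fixed points, where the value does not depend on `n`, but take the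
values `1` and `0` on `P 0`. The unweighted averages of `P 0` tend to `0` on each `e_m`, yet the
`n`-th one fixes `e_n`, so they have no norm limit. -/

noncomputable section

/-! ### Uniformly Lipschitz families of maps -/

/-- An `ε / 2` argument with a Lipschitz constant uniform in `i`. It extends convergence from dense
sets, for averages in the algebra, operators on the GNS space and differences of states. -/
theorem isClosed_setOf_tendsto_zero {ι E F : Type*} [SeminormedAddCommGroup E]
    [SeminormedAddCommGroup F] (l : Filter ι) (T : ι → E → F) (C : ℝ)
    (hT : ∀ i x y, ‖T i x - T i y‖ ≤ C * ‖x - y‖) :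
    IsClosed {x | Tendsto (fun i => T i x) l (𝓝 0)} := by
  rw [← closure_subset_iff_isClosed]
  intro x hx
  rw [Set.mem_ofPred_eq, Metric.tendsto_nhds]
  intro ε hε
  -- `C` has no assumed sign; `|C| + 1` is positive and dominates it.
  obtain ⟨y, hy, hxy⟩ := Metric.mem_closure_iff.1 hx (ε / 2 / (|C| + 1)) (by positivity)
  filter_upwards [(Metric.tendsto_nhds.1 hy) (ε / 2) (half_pos hε)] with i hi
  rw [dist_zero_right] at hi ⊢
  rw [dist_eq_norm, lt_div_iff₀ (by positivity)] at hxy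
  have h1 : C * ‖x - y‖ ≤ ‖x - y‖ * (|C| + 1) := by
    nlinarith [le_abs_self C, norm_nonneg (x - y)]
  have h2 := norm_le_norm_add_norm_sub (T i y) (T i x)
  have h3 := hT i x y
  rw [norm_sub_rev] at h2
  linarith

/-! ### Ergodic averages -/

section ErgodicAverage

variable {A : Type*} [CStarAlgebra A] (Φ : A →⋆ₐ[ℂ] A) {z : ℂ}

theorem iterate_apply_eq_pow (k : ℕ) (a : A) :
    Φ^[k] a = ((Φ.toAlgHom.toLinearMap : Module.End ℂ A) ^ k) a := by
  rw [Module.End.pow_apply]; rfl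

theorem norm_iterate_starAlgHom_le (k : ℕ) (a : A) : ‖Φ^[k] a‖ ≤ ‖a‖ := by
  induction k generalizing a with
  | zero => simp
  | succ k ih =>
    rw [Function.iterate_succ_apply]
    exact (ih _).trans (NonUnitalStarAlgHom.norm_apply_le Φ a)

theorem ergodicAverage_add (n : ℕ) (a b : A) :
    ergodicAverage Φ z n (a + b) = ergodicAverage Φ z n a + ergodicAverage Φ z n b := by
  simp only [ergodicAverage, iterate_apply_eq_pow, map_add, smul_add, Finset.sum_add_distrib]

theorem ergodicAverage_smul (n : ℕ) (c : ℂ) (a : A) :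
    ergodicAverage Φ z n (c • a) = c • ergodicAverage Φ z n a := by
  simp only [ergodicAverage, iterate_apply_eq_pow, map_smul]
  simp only [Finset.smul_sum]
  refine Finset.sum_congr rfl fun k _ => ?_
  rw [smul_comm c (n : ℂ)⁻¹, smul_comm c (z ^ k)⁻¹]

theorem ergodicAverage_sub (n : ℕ) (a b : A) :
    ergodicAverage Φ z n (a - b) = ergodicAverage Φ z n a - ergodicAverage Φ z n b := by
  simp only [ergodicAverage, iterate_apply_eq_pow, map_sub, smul_sub, Finset.sum_sub_distrib]

theorem norm_ergodicAverage_le (hz : ‖z‖ = 1) (n : ℕ) (a : A) :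
    ‖ergodicAverage Φ z n a‖ ≤ ‖a‖ := by
  have h : ‖∑ k ∈ Finset.range n, (z ^ k)⁻¹ • (Φ^[k]) a‖ ≤ n * ‖a‖ := by
    refine (norm_sum_le_of_le _ (f := fun k => (z ^ k)⁻¹ • (Φ^[k]) a) (n := fun _ => ‖a‖)
      fun k _ => ?_).trans (by simp)
    rw [norm_smul, norm_inv, norm_pow, hz, one_pow, inv_one, one_mul]
    exact norm_iterate_starAlgHom_le Φ k a
  rw [ergodicAverage, norm_smul, norm_inv, Complex.norm_natCast]
  rcases Nat.eq_zero_or_pos n with rfl | hn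
  · simp
  · rw [inv_mul_le_iff₀ (by exact_mod_cast hn)]
    exact h

theorem star_iterate_starAlgHom (k : ℕ) (a : A) : star (Φ^[k] a) = Φ^[k] (star a) := by
  induction k generalizing a with
  | zero => rfl
  | succ k ih => rw [Function.iterate_succ_apply, Function.iterate_succ_apply, ih, map_star]

/-- Transfers the result for words starting with a creator to words ending with an annihilator; the
weight is conjugated. -/
theorem star_ergodicAverage (n : ℕ) (a : A) :
    star (ergodicAverage Φ z n a) = ergodicAverage Φ (star z) n (star a) := by
  simp only [ergodicAverage, star_smul, star_sum, star_iterate_starAlgHom, star_inv₀, star_pow,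
    star_natCast]

theorem tendsto_ergodicAverage_one (hz : ‖z‖ = 1) (hz1 : z ≠ 1) :
    Tendsto (fun n : ℕ => ergodicAverage Φ z n 1) atTop (𝓝 0) := by
  have hz0 : z⁻¹ ≠ 1 := by simpa using hz1
  have hone : ∀ k : ℕ, Φ^[k] 1 = 1 := fun k => Function.iterate_fixed (map_one Φ) k
  have hlim : Tendsto (fun n : ℕ => (2 * ‖(1 : A)‖ / ‖z⁻¹ - 1‖) * (n : ℝ)⁻¹) atTop (𝓝 0) := by
    simpa using tendsto_inv_atTop_nhds_zero_nat.const_mul (2 * ‖(1 : A)‖ / ‖z⁻¹ - 1‖)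
  refine squeeze_zero_norm (fun n => ?_) hlim
  have hs : ∑ k ∈ Finset.range n, (z ^ k)⁻¹ • (1 : A) = ((z⁻¹ ^ n - 1) / (z⁻¹ - 1)) • (1 : A) := by
    rw [← Finset.sum_smul, ← geom_sum_eq hz0]
    simp only [inv_pow]
  have hb : ‖z⁻¹ ^ n - 1‖ ≤ 2 := by
    refine (norm_sub_le _ _).trans ?_
    rw [norm_pow, norm_inv, hz]
    norm_num
  simp only [ergodicAverage, hone, hs, norm_smul, norm_inv, Complex.norm_natCast, norm_div]
  rw [mul_comm]
  gcongr
  rw [div_mul_eq_mul_div]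
  gcongr

theorem tendsto_ergodicAverage_apply_sub (hz : ‖z‖ = 1) (a : A) :
    Tendsto (fun n : ℕ => ergodicAverage Φ z n (Φ a - z • a)) atTop (𝓝 0) := by
  have hz0 : z ≠ 0 := fun h => by simp [h] at hz
  have hlim : Tendsto (fun n : ℕ => (2 * ‖a‖) * (n : ℝ)⁻¹) atTop (𝓝 0) := by
    simpa using tendsto_inv_atTop_nhds_zero_nat.const_mul (2 * ‖a‖)
  refine squeeze_zero_norm (fun n => ?_) hlim
  -- With `u k = (z ^ k)⁻¹ • Φ^[k] a`, the `k`-th summand is `z • (u (k + 1) - u k)`, so the sum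
  -- telescopes.
  have hs : ∑ k ∈ Finset.range n, (z ^ k)⁻¹ • Φ^[k] (Φ a - z • a) =
      z • ((z ^ n)⁻¹ • Φ^[n] a - a) := by
    have := Finset.sum_range_sub (fun k => z • (z ^ k)⁻¹ • Φ^[k] a) n
    rw [smul_sub]
    simp only [pow_zero, inv_one, one_smul, Function.iterate_zero, id] at this
    rw [← this]
    refine Finset.sum_congr rfl fun k _ => ?_
    rw [Function.iterate_succ_apply, iterate_apply_eq_pow, map_sub, map_smul,
      ← iterate_apply_eq_pow, ← iterate_apply_eq_pow, smul_sub, smul_comm z (z ^ k)⁻¹,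
      smul_smul z (z ^ (k + 1))⁻¹]
    congr 2
    rw [pow_succ]
    field_simp
  rw [ergodicAverage, hs, norm_smul, norm_smul, norm_inv, Complex.norm_natCast, hz, one_mul,
    mul_comm]
  gcongr
  refine (norm_sub_le _ _).trans ?_
  rw [norm_smul, norm_inv, norm_pow, hz, one_pow, inv_one, one_mul, two_mul]
  gcongr
  exact norm_iterate_starAlgHom_le Φ n a

/-- By the C⋆-identity the squared norm of the sum is the norm of a double sum. Its off-diagonal
terms vanish, leaving at most `n * ‖a‖ ^ 2`. The weight `z = 1` is allowed. -/
theorem tendsto_ergodicAverage_of_orthogonal (hz : ‖z‖ = 1) (a : A)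
    (ha : ∀ j k : ℕ, j ≠ k → star (Φ^[j] a) * Φ^[k] a = 0) :
    Tendsto (fun n : ℕ => ergodicAverage Φ z n a) atTop (𝓝 0) := by
  have hlim : Tendsto (fun n : ℕ => Real.sqrt (‖a‖ ^ 2 * (n : ℝ)⁻¹)) atTop (𝓝 0) := by
    simpa only [mul_zero, Real.sqrt_zero] using
      (tendsto_inv_atTop_nhds_zero_nat.const_mul (‖a‖ ^ 2)).sqrt
  refine squeeze_zero_norm (fun n => Real.le_sqrt_of_sq_le ?_) hlim
  have hsum : ‖∑ k ∈ Finset.range n, (z ^ k)⁻¹ • (Φ^[k]) a‖ ^ 2 ≤ n * ‖a‖ ^ 2 := by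
    rw [pow_two, ← CStarRing.norm_star_mul_self, star_sum, Finset.sum_mul_sum]
    refine (norm_sum_le_of_le _ (n := fun _ => ‖a‖ ^ 2) fun j hj => ?_).trans (by simp)
    rw [Finset.sum_eq_single j]
    · rw [CStarRing.norm_star_mul_self, norm_smul, norm_inv, norm_pow, hz, one_pow, inv_one,
        one_mul, pow_two]
      have := norm_iterate_starAlgHom_le Φ j a
      gcongr
    · intro k _ hk
      rw [star_smul, smul_mul_smul_comm, ha j k hk.symm, smul_zero]
    · exact fun h => absurd hj h
  rw [ergodicAverage, norm_smul, norm_inv, Complex.norm_natCast, mul_pow]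
  rcases Nat.eq_zero_or_pos n with rfl | hn
  · simp
  · have hn' : (0 : ℝ) < n := by exact_mod_cast hn
    calc ((n : ℝ)⁻¹) ^ 2 * _ ≤ ((n : ℝ)⁻¹) ^ 2 * (n * ‖a‖ ^ 2) := by gcongr
      _ = ‖a‖ ^ 2 * (n : ℝ)⁻¹ := by field_simp

end ErgodicAverage

/-! ### Relations between the monotone creators -/

theorem creator_apply_nil (i : ℤ) (ψ : MonotoneFock) (h : ([] : List ℤ).Pairwise (· < ·)) :
    creator i ψ ⟨[], h⟩ = 0 := rfl

theorem creator_apply_cons (i j : ℤ) (l : List ℤ) (h : (j :: l).Pairwise (· < ·))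
    (ψ : MonotoneFock) :
    creator i ψ ⟨j :: l, h⟩ = if j = i then ψ ⟨l, h.of_cons⟩ else 0 := by
  change (if j = i then some (⟨l, h.of_cons⟩ : IncSeq) else none).elim 0 ψ = _
  split_ifs <;> rfl

theorem star_creator_apply (i : ℤ) (t : IncSeq) (ψ : MonotoneFock) :
    star (creator i) ψ t = if h : (i :: t.1).Pairwise (· < ·) then ψ ⟨i :: t.1, h⟩ else 0 := by
  rw [ContinuousLinearMap.star_eq_adjoint, creator, adjoint_partialIsometry]
  change (if h : (i :: t.1).Pairwise (· < ·) then some (⟨i :: t.1, h⟩ : IncSeq) else none).elim 0 ψ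
    = _
  split_ifs <;> rfl

theorem star_creator_mul_creator_apply (i : ℤ) (t : IncSeq) (ψ : MonotoneFock) :
    (star (creator i) * creator i) ψ t = if (i :: t.1).Pairwise (· < ·) then ψ t else 0 := by
  rw [mul_apply_eq_comp, star_creator_apply]
  split_ifs with h
  · rw [creator_apply_cons, if_pos rfl]
  · rfl

theorem star_creator_mul_creator_of_ne {i j : ℤ} (hij : i ≠ j) :
    star (creator i) * creator j = 0 := by
  ext ψ t
  rw [mul_apply_eq_comp, star_creator_apply]
  split_ifs with h
  · rw [creator_apply_cons, if_neg hij]; rfl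
  · rfl

theorem pairwise_cons_cons_iff {i k : ℤ} {l : List ℤ} (hl : (k :: l).Pairwise (· < ·)) :
    (i :: k :: l).Pairwise (· < ·) ↔ i < k := by
  refine ⟨fun h => List.rel_of_pairwise_cons h (by simp), fun h => ?_⟩
  refine List.pairwise_cons.2 ⟨fun a ha => ?_, hl⟩
  rcases List.mem_cons.1 ha with rfl | ha
  · exact h
  · exact h.trans (List.rel_of_pairwise_cons hl ha)

/-- The range of `creator j` is spanned by sequences starting with `j`; all their entries exceed `i`
exactly when `i < j`. -/
theorem range_projection_mul_creator (i j : ℤ) :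
    star (creator i) * creator i * creator j = if i < j then creator j else 0 := by
  ext ψ ⟨t, ht⟩
  rw [mul_apply_eq_comp, star_creator_mul_creator_apply]
  cases t with
  | nil =>
    rw [creator_apply_nil]
    split_ifs <;> rfl
  | cons k l =>
    rw [creator_apply_cons]
    by_cases hkj : k = j
    · subst hkj
      simp only [pairwise_cons_cons_iff ht]
      split_ifs with h
      · rw [creator_apply_cons, if_pos rfl]
      · rfl
    · rw [if_neg hkj, ite_self]
      split_ifs
      · rw [creator_apply_cons, if_neg hkj]
      · rfl

theorem star_creator_mul_range_projection (i j : ℤ) :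
    star (creator j) * (star (creator i) * creator i) = if i < j then star (creator j) else 0 := by
  have := congrArg star (range_projection_mul_creator i j)
  rw [star_mul, star_mul, star_star] at this
  rw [this]
  split_ifs <;> simp

theorem pairwise_cons_of_le {i j : ℤ} (hij : i ≤ j) {l : List ℤ}
    (h : (j :: l).Pairwise (· < ·)) : (i :: l).Pairwise (· < ·) := by
  rw [List.pairwise_cons] at h ⊢
  exact ⟨fun a ha => hij.trans_lt (h.1 a ha), h.2⟩

theorem range_projection_mul_range_projection (i j : ℤ) :
    star (creator i) * creator i * (star (creator j) * creator j) =
      star (creator (max i j)) * creator (max i j) := by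
  ext ψ t
  rw [mul_apply_eq_comp]
  simp only [star_creator_mul_creator_apply]
  rcases le_total i j with h | h
  · rw [max_eq_right h]
    by_cases hj : (j :: t.1).Pairwise (· < ·)
    · rw [if_pos (pairwise_cons_of_le h hj)]
    · rw [if_neg hj, ite_self]
  · rw [max_eq_left h]
    by_cases hi : (i :: t.1).Pairwise (· < ·)
    · rw [if_pos hi, if_pos hi, if_pos (pairwise_cons_of_le h hi)]
    · rw [if_neg hi, if_neg hi]

/-- Both sides project onto the sequences whose first entry is exactly `i + 1`. This identity ties
the range projections to words with orthogonal shifts. -/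
theorem range_projection_sub_succ (i : ℤ) :
    star (creator i) * creator i - star (creator (i + 1)) * creator (i + 1) =
      creator (i + 1) * star (creator (i + 1)) := by
  ext ψ ⟨t, ht⟩
  change (star (creator i) * creator i) ψ ⟨t, ht⟩ -
    (star (creator (i + 1)) * creator (i + 1)) ψ ⟨t, ht⟩ =
    creator (i + 1) (star (creator (i + 1)) ψ) ⟨t, ht⟩
  rw [star_creator_mul_creator_apply, star_creator_mul_creator_apply]
  cases t with
  | nil => simp [creator_apply_nil]
  | cons k l =>
    rw [creator_apply_cons]
    simp only [pairwise_cons_cons_iff ht]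
    by_cases hk : k = i + 1
    · subst hk
      rw [if_pos rfl, star_creator_apply, dif_pos ht, if_pos (by omega), if_neg (by omega),
        sub_zero]
    · rw [if_neg hk]
      by_cases h : i < k
      · rw [if_pos h, if_pos (by omega), sub_self]
      · rw [if_neg h, if_neg (by omega), sub_self]

/-! ### Normal form of words in the creators and annihilators -/

/-- The operators obtained from `1` and the range projections `mᵢ m†ᵢ` by multiplying by
creators on the left and by annihilators on the right. -/
inductive IsNormalWord : (MonotoneFock →L[ℂ] MonotoneFock) → Prop
  | one : IsNormalWord 1
  | proj (i : ℤ) : IsNormalWord (star (creator i) * creator i)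
  | creator_mul (i : ℤ) {x : MonotoneFock →L[ℂ] MonotoneFock} :
      IsNormalWord x → IsNormalWord (creator i * x)
  | mul_annihilator (i : ℤ) {x : MonotoneFock →L[ℂ] MonotoneFock} :
      IsNormalWord x → IsNormalWord (x * star (creator i))

theorem IsNormalWord.mem {x : MonotoneFock →L[ℂ] MonotoneFock} (hx : IsNormalWord x) :
    x ∈ monotoneAlgebra := by
  induction hx with
  | one => exact one_mem _
  | proj i => exact mul_mem (star_mem (creator_mem i)) (creator_mem i)
  | creator_mul i _ ih => exact mul_mem (creator_mem i) ih
  | mul_annihilator i _ ih => exact mul_mem ih (star_mem (creator_mem i))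

/-- A leading creator absorbs or kills the projection. This is the case left over when an
annihilator meets the creator of the same index. -/
theorem IsNormalWord.proj_mul (i : ℤ) {x : MonotoneFock →L[ℂ] MonotoneFock}
    (hx : IsNormalWord x) :
    star (creator i) * creator i * x = 0 ∨ IsNormalWord (star (creator i) * creator i * x) := by
  induction hx with
  | one => rw [mul_one]; exact Or.inr (.proj i)
  | proj j => rw [range_projection_mul_range_projection]; exact Or.inr (.proj _)
  | creator_mul j hx _ =>
    rw [← mul_assoc, range_projection_mul_creator]
    split_ifs
    · exact Or.inr (.creator_mul j hx)
    · exact Or.inl (zero_mul _)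
  | mul_annihilator j _ ih =>
    rw [← mul_assoc]
    rcases ih with h | h
    · exact Or.inl (by rw [h, zero_mul])
    · exact Or.inr (.mul_annihilator j h)

theorem IsNormalWord.annihilator_mul (i : ℤ) {x : MonotoneFock →L[ℂ] MonotoneFock}
    (hx : IsNormalWord x) :
    star (creator i) * x = 0 ∨ IsNormalWord (star (creator i) * x) := by
  induction hx with
  | one => simpa using Or.inr (IsNormalWord.mul_annihilator i .one)
  | proj j =>
    rw [star_creator_mul_range_projection]
    split_ifs
    · simpa using Or.inr (IsNormalWord.mul_annihilator i .one)
    · exact Or.inl rfl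
  | creator_mul j hx _ =>
    rw [← mul_assoc]
    by_cases hij : i = j
    · subst hij
      exact hx.proj_mul i
    · exact Or.inl (by rw [star_creator_mul_creator_of_ne hij, zero_mul])
  | mul_annihilator j _ ih =>
    rw [← mul_assoc]
    rcases ih with h | h
    · exact Or.inl (by rw [h, zero_mul])
    · exact Or.inr (.mul_annihilator j h)

/-- The span of normal words is a left module over the generated ⋆-algebra. Tracking `x` and `star
x` together makes the star case of the induction a mere swap. -/
theorem mul_mem_span_isNormalWord {x : MonotoneFock →L[ℂ] MonotoneFock}
    (hx : x ∈ StarAlgebra.adjoin ℂ (Set.range creator)) :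
    (∀ y ∈ Submodule.span ℂ {w | IsNormalWord w}, x * y ∈ Submodule.span ℂ {w | IsNormalWord w}) ∧
    (∀ y ∈ Submodule.span ℂ {w | IsNormalWord w},
      star x * y ∈ Submodule.span ℂ {w | IsNormalWord w}) := by
  have key : ∀ a : MonotoneFock →L[ℂ] MonotoneFock,
      (∀ w, IsNormalWord w → a * w = 0 ∨ IsNormalWord (a * w)) →
      ∀ y ∈ Submodule.span ℂ {w | IsNormalWord w},
        a * y ∈ Submodule.span ℂ {w | IsNormalWord w} := by
    intro a ha y hy
    induction hy using Submodule.span_induction with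
    | mem w hw =>
      rcases ha w hw with h | h
      · rw [h]; exact zero_mem _
      · exact Submodule.subset_span h
    | zero => rw [mul_zero]; exact zero_mem _
    | add u v _ _ hu hv => rw [mul_add]; exact add_mem hu hv
    | smul c u _ hu => rw [mul_smul_comm]; exact Submodule.smul_mem _ c hu
  induction hx using StarAlgebra.adjoin_induction with
  | mem x hx =>
    obtain ⟨i, rfl⟩ := hx
    exact ⟨key _ fun w hw => Or.inr (.creator_mul i hw), key _ fun w hw => hw.annihilator_mul i⟩
  | algebraMap r =>
    refine ⟨fun y hy => ?_, fun y hy => ?_⟩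
    · rw [← Algebra.smul_def]; exact Submodule.smul_mem _ _ hy
    · rw [← algebraMap_star_comm, ← Algebra.smul_def]; exact Submodule.smul_mem _ _ hy
  | add u v _ _ hu hv =>
    refine ⟨fun y hy => ?_, fun y hy => ?_⟩
    · rw [add_mul]; exact add_mem (hu.1 y hy) (hv.1 y hy)
    · rw [star_add, add_mul]; exact add_mem (hu.2 y hy) (hv.2 y hy)
  | mul u v _ _ hu hv =>
    refine ⟨fun y hy => ?_, fun y hy => ?_⟩
    · rw [mul_assoc]; exact hu.1 _ (hv.1 y hy)
    · rw [star_mul, mul_assoc]; exact hv.2 _ (hu.2 y hy)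
  | star u _ hu => exact ⟨hu.2, by simpa using hu.1⟩

/-- The creator `m†ᵢ` as an element of the monotone C⋆-algebra. -/
def creatorElt (i : ℤ) : monotoneAlgebra := ⟨creator i, creator_mem i⟩

/-- Density of the span of normal words, as an induction principle. The factor `y` is arbitrary
because every application depends on the outermost factor alone, so no induction on word length is
needed. -/
theorem monotoneAlgebra_induction {p : monotoneAlgebra → Prop} (hclosed : IsClosed {x | p x})
    (add : ∀ x y, p x → p y → p (x + y)) (smul : ∀ (c : ℂ) x, p x → p (c • x))
    (one : p 1) (proj : ∀ i, p (star (creatorElt i) * creatorElt i))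
    (creator_mul : ∀ i y, p (creatorElt i * y))
    (mul_annihilator : ∀ i y, p (y * star (creatorElt i))) (x : monotoneAlgebra) : p x := by
  have hspan : ∀ y ∈ Submodule.span ℂ {w | IsNormalWord w}, ∃ h : y ∈ monotoneAlgebra, p ⟨y, h⟩ := by
    intro y hy
    induction hy using Submodule.span_induction with
    | mem w hw =>
      refine ⟨hw.mem, ?_⟩
      cases hw with
      | one => exact one
      | proj i => exact proj i
      | creator_mul i h => exact creator_mul i ⟨_, h.mem⟩
      | mul_annihilator i h => exact mul_annihilator i ⟨_, h.mem⟩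
    | zero =>
      refine ⟨zero_mem _, ?_⟩
      have := smul 0 1 one
      rwa [zero_smul] at this
    | add u v _ _ hu hv =>
      obtain ⟨hu, hpu⟩ := hu
      obtain ⟨hv, hpv⟩ := hv
      exact ⟨add_mem hu hv, add _ _ hpu hpv⟩
    | smul c u _ hu =>
      obtain ⟨hu, hpu⟩ := hu
      exact ⟨SMulMemClass.smul_mem c hu, smul c _ hpu⟩
  have hadj : ∀ y ∈ StarAlgebra.adjoin ℂ (Set.range creator),
      ∃ h : y ∈ monotoneAlgebra, p ⟨y, h⟩ := by
    intro y hy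
    have := (mul_mem_span_isNormalWord hy).1 1 (Submodule.subset_span IsNormalWord.one)
    rw [mul_one] at this
    exact hspan y this
  have hx : (x : MonotoneFock →L[ℂ] MonotoneFock) ∈
      closure (StarAlgebra.adjoin ℂ (Set.range creator) : Set (MonotoneFock →L[ℂ] MonotoneFock)) :=
    x.2
  obtain ⟨u, hu, hlim⟩ := mem_closure_iff_seq_limit.1 hx
  choose hm hp using fun n => hadj (u n) (hu n)
  exact hclosed.mem_of_tendsto (f := fun n => (⟨u n, hm n⟩ : monotoneAlgebra))
    (tendsto_subtype_rng.2 hlim) (Eventually.of_forall hp)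

theorem range_projection_creatorElt_sub (i : ℤ) :
    star (creatorElt i) * creatorElt i - star (creatorElt (i + 1)) * creatorElt (i + 1) =
      creatorElt (i + 1) * star (creatorElt (i + 1)) :=
  Subtype.ext (range_projection_sub_succ i)

theorem iterate_monotoneShift_creatorElt (k : ℕ) (i : ℤ) :
    monotoneShift^[k] (creatorElt i) = creatorElt (i + k) := by
  induction k generalizing i with
  | zero => simp
  | succ k ih =>
    rw [Function.iterate_succ_apply, creatorElt, monotoneShift_creator]
    change monotoneShift^[k] (creatorElt (i + 1)) = _
    rw [ih]
    congr 1
    push_cast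
    ring

/-! ### Convergence of weighted averages -/

theorem tendsto_ergodicAverage_creatorElt_mul {z : ℂ} (hz : ‖z‖ = 1) (i : ℤ)
    (y : monotoneAlgebra) :
    Tendsto (fun n : ℕ => ergodicAverage monotoneShift z n (creatorElt i * y)) atTop (𝓝 0) := by
  refine tendsto_ergodicAverage_of_orthogonal _ hz _ fun j k hjk => ?_
  have h0 : star (creatorElt (i + j)) * creatorElt (i + k) = 0 :=
    Subtype.ext (star_creator_mul_creator_of_ne (by omega))
  rw [iterate_map_mul, iterate_map_mul, iterate_monotoneShift_creatorElt,
    iterate_monotoneShift_creatorElt, star_mul, mul_assoc, ← mul_assoc _ (creatorElt _), h0,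
    zero_mul, mul_zero]

theorem tendsto_ergodicAverage_of_star {A : Type*} [CStarAlgebra A] {Φ : A →⋆ₐ[ℂ] A} {z : ℂ}
    {a : A} (h : Tendsto (fun n : ℕ => ergodicAverage Φ (star z) n (star a)) atTop (𝓝 0)) :
    Tendsto (fun n : ℕ => ergodicAverage Φ z n a) atTop (𝓝 0) := by
  simpa [star_ergodicAverage] using h.star

theorem tendsto_ergodicAverage_mul_annihilator {z : ℂ} (hz : ‖z‖ = 1) (i : ℤ)
    (y : monotoneAlgebra) :
    Tendsto (fun n : ℕ => ergodicAverage monotoneShift z n (y * star (creatorElt i)))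
      atTop (𝓝 0) := by
  refine tendsto_ergodicAverage_of_star ?_
  rw [star_mul, star_star]
  exact tendsto_ergodicAverage_creatorElt_mul (by rwa [norm_star]) i _

theorem monotoneShift_range_projection (i : ℤ) :
    monotoneShift (star (creatorElt i) * creatorElt i) =
      star (creatorElt (i + 1)) * creatorElt (i + 1) := by
  have h := iterate_monotoneShift_creatorElt 1 i
  simp only [Function.iterate_one, Nat.cast_one] at h
  rw [map_mul, map_star, h]

theorem tendsto_ergodicAverage_range_projection {z : ℂ} (hz : ‖z‖ = 1) (hz1 : z ≠ 1) (i : ℤ) :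
    Tendsto (fun n : ℕ => ergodicAverage monotoneShift z n (star (creatorElt i) * creatorElt i))
      atTop (𝓝 0) := by
  have h1 := tendsto_ergodicAverage_apply_sub monotoneShift hz (star (creatorElt i) * creatorElt i)
  have h2 := tendsto_ergodicAverage_creatorElt_mul hz (i + 1) (star (creatorElt (i + 1)))
  rw [← range_projection_creatorElt_sub, ← monotoneShift_range_projection] at h2
  -- With `P` the range projection and `s` the shift, `(1 - z) • P = (s P - z • P) + (P - s P)`.
  have h3 := (h1.add h2).const_smul (1 - z)⁻¹
  rw [add_zero, smul_zero] at h3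
  refine h3.congr fun n => ?_
  rw [← ergodicAverage_add, ← ergodicAverage_smul]
  congr 1
  rw [inv_smul_eq_iff₀ (sub_ne_zero.2 hz1.symm), sub_smul, one_smul]
  abel

theorem tendsto_ergodicAverage_monotoneShift {z : ℂ} (hz : ‖z‖ = 1) (hz1 : z ≠ 1)
    (x : monotoneAlgebra) :
    Tendsto (fun n : ℕ => ergodicAverage monotoneShift z n x) atTop (𝓝 0) := by
  induction x using monotoneAlgebra_induction with
  | hclosed =>
    refine isClosed_setOf_tendsto_zero _ _ 1 fun n x y => ?_
    rw [← ergodicAverage_sub, one_mul]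
    exact norm_ergodicAverage_le _ hz _ _
  | add x y hx hy => simpa only [ergodicAverage_add, add_zero] using hx.add hy
  | smul c x hx => simpa only [ergodicAverage_smul, smul_zero] using hx.const_smul c
  | one => exact tendsto_ergodicAverage_one _ hz hz1
  | proj i => exact tendsto_ergodicAverage_range_projection hz hz1 i
  | creator_mul i y => exact tendsto_ergodicAverage_creatorElt_mul hz i y
  | mul_annihilator i y => exact tendsto_ergodicAverage_mul_annihilator hz i y

/-! ### Eigenvalues of the covariant isometries -/

section GNS

variable {A : Type*} [CStarAlgebra A]

/-- The element `‖a‖ ^ 2 • 1 - star a * a` is nonnegative, hence of the form `star b * b`, where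
positivity of the state applies. -/
theorem AlgState.apply_star_mul_self_le (φ : AlgState A) (a : A) :
    (φ.toLinearMap (star a * a)).re ≤ ‖a‖ ^ 2 := by
  let _ := CStarAlgebra.spectralOrder A
  let _ := CStarAlgebra.spectralOrderedRing A
  obtain ⟨b, hb⟩ := CStarAlgebra.nonneg_iff_eq_star_mul_self.1
    (sub_nonneg.2 (CStarAlgebra.star_mul_le_algebraMap_norm_sq (a := a)))
  have h := (Complex.le_def.1 (φ.nonneg b)).1
  have hc : (algebraMap ℝ A) (‖a‖ ^ 2) = ((‖a‖ ^ 2 : ℝ) : ℂ) • (1 : A) := by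
    rw [Algebra.algebraMap_eq_smul_one, Complex.coe_smul]
  rw [← hb, map_sub, hc, map_smul, φ.map_one, smul_eq_mul, mul_one, Complex.sub_re,
    Complex.ofReal_re, Complex.zero_re] at h
  linarith

theorem norm_gnsClass_le (φ : AlgState A) (a : A) : ‖gnsClass φ a‖ ≤ ‖a‖ := by
  have h := inner_self_eq_norm_sq (𝕜 := ℂ) (gnsClass φ a)
  rw [inner_gnsClass] at h
  have h2 := φ.apply_star_mul_self_le a
  refine le_of_sq_le_sq ?_ (norm_nonneg _)
  rw [← h]
  exact h2

theorem gnsClass_add (φ : AlgState A) (a b : A) :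
    gnsClass φ (a + b) = gnsClass φ a + gnsClass φ b := by
  simp only [gnsClass, map_add, UniformSpace.Completion.coe_add]

theorem gnsClass_smul (φ : AlgState A) (c : ℂ) (a : A) :
    gnsClass φ (c • a) = c • gnsClass φ a := by
  simp only [gnsClass, map_smul, UniformSpace.Completion.coe_smul]

/-- The map `a ↦ π_φ(a) ξ_φ` as a linear map. -/
def gnsClassLinear (φ : AlgState A) : A →ₗ[ℂ] φ.GNSSpace where
  toFun := gnsClass φ
  map_add' := gnsClass_add φ
  map_smul' := gnsClass_smul φ

theorem dense_range_gnsClass (φ : AlgState A) : DenseRange (gnsClass φ) := by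
  let _ := CStarAlgebra.spectralOrder A
  let _ := CStarAlgebra.spectralOrderedRing A
  have h : Function.Surjective φ.toPositive.toPreGNS := φ.toPositive.toPreGNS.surjective
  exact UniformSpace.Completion.denseRange_coe.comp h.denseRange
    (UniformSpace.Completion.continuous_coe _)

theorem norm_covariantIsometry_apply_le (φ : AlgState A) (Φ : A →⋆ₐ[ℂ] A) (h : φ.IsInvariant Φ)
    (v : φ.GNSSpace) : ‖covariantIsometry φ Φ h v‖ ≤ ‖v‖ := by
  refine (dense_range_gnsClass φ).induction_on v (isClosed_le (by fun_prop) (by fun_prop))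
    fun a => ?_
  rw [covariantIsometry_gnsClass]
  refine le_of_sq_le_sq ?_ (norm_nonneg _)
  rw [← inner_self_eq_norm_sq (𝕜 := ℂ), ← inner_self_eq_norm_sq (𝕜 := ℂ), inner_gnsClass,
    inner_gnsClass, ← map_star, ← map_mul, h]

theorem iterate_covariantIsometry_gnsClass (φ : AlgState A) (Φ : A →⋆ₐ[ℂ] A)
    (h : φ.IsInvariant Φ) (k : ℕ) (a : A) :
    (covariantIsometry φ Φ h ^ k) (gnsClass φ a) = gnsClass φ (Φ^[k] a) := by
  induction k generalizing a with
  | zero => rfl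
  | succ k ih =>
    rw [pow_succ, mul_apply_eq_comp, covariantIsometry_gnsClass, ih, Function.iterate_succ_apply]

theorem norm_covariantIsometry_pow_apply_le (φ : AlgState A) (Φ : A →⋆ₐ[ℂ] A)
    (h : φ.IsInvariant Φ) (k : ℕ) (v : φ.GNSSpace) :
    ‖(covariantIsometry φ Φ h ^ k) v‖ ≤ ‖v‖ := by
  induction k generalizing v with
  | zero => exact le_rfl
  | succ k ih =>
    rw [pow_succ, mul_apply_eq_comp]
    exact (ih _).trans (norm_covariantIsometry_apply_le φ Φ h v)

/-- The weighted ergodic average of the covariant isometry. -/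
def covariantAverage (φ : AlgState A) (Φ : A →⋆ₐ[ℂ] A) (h : φ.IsInvariant Φ) (z : ℂ) (n : ℕ) :
    φ.GNSSpace →L[ℂ] φ.GNSSpace :=
  (n : ℂ)⁻¹ • ∑ k ∈ Finset.range n, (z ^ k)⁻¹ • covariantIsometry φ Φ h ^ k

theorem covariantAverage_apply (φ : AlgState A) (Φ : A →⋆ₐ[ℂ] A) (h : φ.IsInvariant Φ) (z : ℂ)
    (n : ℕ) (v : φ.GNSSpace) :
    covariantAverage φ Φ h z n v =
      (n : ℂ)⁻¹ • ∑ k ∈ Finset.range n, (z ^ k)⁻¹ • (covariantIsometry φ Φ h ^ k) v := by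
  simp [covariantAverage]

theorem covariantAverage_gnsClass (φ : AlgState A) (Φ : A →⋆ₐ[ℂ] A) (h : φ.IsInvariant Φ) (z : ℂ)
    (n : ℕ) (a : A) :
    covariantAverage φ Φ h z n (gnsClass φ a) = gnsClass φ (ergodicAverage Φ z n a) := by
  change _ = gnsClassLinear φ _
  rw [covariantAverage_apply, ergodicAverage, map_smul, map_sum]
  congr 1
  refine Finset.sum_congr rfl fun k _ => ?_
  rw [map_smul, iterate_covariantIsometry_gnsClass]
  rfl

theorem norm_covariantAverage_apply_le (φ : AlgState A) (Φ : A →⋆ₐ[ℂ] A) (h : φ.IsInvariant Φ)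
    {z : ℂ} (hz : ‖z‖ = 1) (n : ℕ) (v : φ.GNSSpace) :
    ‖covariantAverage φ Φ h z n v‖ ≤ ‖v‖ := by
  refine (dense_range_gnsClass φ).induction_on v (isClosed_le (by fun_prop) (by fun_prop))
    fun a => ?_
  have hb : ‖∑ k ∈ Finset.range n, (z ^ k)⁻¹ • (covariantIsometry φ Φ h ^ k) (gnsClass φ a)‖ ≤
      n * ‖gnsClass φ a‖ := by
    refine (norm_sum_le_of_le _ (n := fun _ => ‖gnsClass φ a‖) fun k _ => ?_).trans (by simp)
    rw [norm_smul, norm_inv, norm_pow, hz, one_pow, inv_one, one_mul]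
    exact norm_covariantIsometry_pow_apply_le φ Φ h k _
  rw [covariantAverage_apply, norm_smul, norm_inv, Complex.norm_natCast]
  rcases Nat.eq_zero_or_pos n with rfl | hn
  · simp
  · rw [inv_mul_le_iff₀ (by exact_mod_cast hn)]
    exact hb

/-- The weighted averages of the isometry are contractions tending to `0` on the dense set of
classes, hence everywhere, yet they fix an eigenvector for `z`. -/
theorem not_hasEigenvalue_of_tendsto_ergodicAverage {Φ : A →⋆ₐ[ℂ] A} {z : ℂ} (hz : ‖z‖ = 1)
    (hΦ : ∀ a, Tendsto (fun n : ℕ => ergodicAverage Φ z n a) atTop (𝓝 0))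
    (φ : AlgState A) (h : φ.IsInvariant Φ) :
    ¬ Module.End.HasEigenvalue
      ((covariantIsometry φ Φ h : φ.GNSSpace →ₗ[ℂ] φ.GNSSpace) : Module.End ℂ φ.GNSSpace) z := by
  intro hev
  obtain ⟨v, hv⟩ := hev.exists_hasEigenvector
  have hz0 : z ≠ 0 := fun h => by simp [h] at hz
  have hVv : covariantIsometry φ Φ h v = z • v := hv.apply_eq_smul
  have hpow : ∀ k : ℕ, (covariantIsometry φ Φ h ^ k) v = z ^ k • v := by
    intro k
    induction k with
    | zero => simp
    | succ k ih => rw [pow_succ', mul_apply_eq_comp, ih, map_smul, hVv, smul_smul, pow_succ]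
  have hlim : Tendsto (fun n : ℕ => covariantAverage φ Φ h z n v) atTop (𝓝 0) := by
    refine (dense_range_gnsClass φ).induction_on
      (p := fun v => Tendsto (fun n : ℕ => covariantAverage φ Φ h z n v) atTop (𝓝 0)) v
      (isClosed_setOf_tendsto_zero _ _ 1 fun n x y => ?_) fun a => ?_
    · rw [← map_sub, one_mul]
      exact norm_covariantAverage_apply_le φ Φ h hz n _
    · simp only [covariantAverage_gnsClass]
      exact squeeze_zero_norm (fun n => norm_gnsClass_le φ _) (by simpa using (hΦ a).norm)
  refine hv.2 (tendsto_nhds_unique (tendsto_const_nhds.congr' ?_) hlim)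
  filter_upwards [eventually_gt_atTop 0] with n hn
  have hn' : (n : ℂ) ≠ 0 := by exact_mod_cast hn.ne'
  rw [covariantAverage_apply, eq_inv_smul_iff₀ hn']
  simp only [hpow]
  rw [Finset.sum_congr rfl fun k _ => inv_smul_smul₀ (pow_ne_zero k hz0) v]
  simp [Nat.cast_smul_eq_nsmul]

theorem hasEigenvalue_covariantIsometry_one (φ : AlgState A) (Φ : A →⋆ₐ[ℂ] A)
    (h : φ.IsInvariant Φ) :
    Module.End.HasEigenvalue
      ((covariantIsometry φ Φ h : φ.GNSSpace →ₗ[ℂ] φ.GNSSpace) : Module.End ℂ φ.GNSSpace) 1 := by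
  refine Module.End.hasEigenvalue_of_hasEigenvector (x := gnsClass φ 1)
    ⟨Module.End.mem_eigenspace_iff.2 ?_, fun h0 => ?_⟩
  · rw [one_smul]
    exact (covariantIsometry_gnsClass φ Φ h 1).trans (by rw [map_one])
  · have := inner_gnsClass φ 1 1
    rw [h0, inner_zero_left, star_one, one_mul, φ.map_one] at this
    exact zero_ne_one this

end GNS

/-! ### The one-particle vectors -/

/-- The one-particle basis vector `e_n`. -/
def oneParticle (n : ℤ) : MonotoneFock := fockBasis ⟨[n], List.pairwise_singleton _ n⟩

theorem norm_fockBasis (t : IncSeq) : ‖fockBasis t‖ = 1 := by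
  rw [fockBasis, lp.norm_single (by norm_num), norm_one]

theorem norm_vacuum : ‖vacuum‖ = 1 := norm_fockBasis _

theorem norm_oneParticle (n : ℤ) : ‖oneParticle n‖ = 1 := norm_fockBasis _

theorem star_creator_vacuum (i : ℤ) : star (creator i) vacuum = 0 := by
  rw [ContinuousLinearMap.star_eq_adjoint, creator, adjoint_partialIsometry]
  exact partialIsometry_single_none _ rfl

theorem star_creator_oneParticle_of_ne {i n : ℤ} (h : n ≠ i) :
    star (creator i) (oneParticle n) = 0 := by
  rw [ContinuousLinearMap.star_eq_adjoint, creator, adjoint_partialIsometry]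
  refine partialIsometry_single_none _ ?_
  change (if n = i then _ else _) = _
  rw [if_neg h]

theorem range_projection_fockBasis (i : ℤ) (t : IncSeq) :
    (star (creator i) * creator i) (fockBasis t) =
      if (i :: t.1).Pairwise (· < ·) then fockBasis t else 0 := by
  ext u
  rw [star_creator_mul_creator_apply]
  by_cases hut : u = t
  · subst hut
    split_ifs <;> rfl
  · have h0 : fockBasis t u = 0 := by simp [fockBasis, lp.single_apply, hut]
    rw [h0, ite_self]
    split_ifs
    · exact h0.symm
    · rfl

theorem range_projection_vacuum (i : ℤ) : (star (creator i) * creator i) vacuum = vacuum := by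
  rw [vacuum, range_projection_fockBasis]
  exact if_pos (List.pairwise_singleton _ i)

theorem range_projection_oneParticle (i n : ℤ) :
    (star (creator i) * creator i) (oneParticle n) = if i < n then oneParticle n else 0 := by
  rw [oneParticle, range_projection_fockBasis]
  simp

theorem star_fockShift_oneParticle (n : ℤ) :
    star (fockShift : MonotoneFock →L[ℂ] MonotoneFock) (oneParticle n) = oneParticle (n - 1) := by
  change star (partialIsometry (shiftIndex 1)) _ = _
  rw [ContinuousLinearMap.star_eq_adjoint, adjoint_partialIsometry]
  exact partialIsometry_single_some _ rfl

theorem star_fockShift_vacuum :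
    star (fockShift : MonotoneFock →L[ℂ] MonotoneFock) vacuum = vacuum := by
  change star (partialIsometry (shiftIndex 1)) _ = _
  rw [ContinuousLinearMap.star_eq_adjoint, adjoint_partialIsometry]
  exact partialIsometry_single_some _ rfl

/-! ### Vector states -/

/-- The vector state `x ↦ ⟨v, x v⟩`. -/
def vectorState (v : MonotoneFock) (hv : ‖v‖ = 1) : AlgState monotoneAlgebra where
  toLinearMap :=
    { toFun := fun x => inner ℂ v ((x : MonotoneFock →L[ℂ] MonotoneFock) v)
      map_add' := fun x y => inner_add_right v _ _
      map_smul' := fun c x => inner_smul_right v _ c }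
  nonneg := fun a => by
    change 0 ≤ inner ℂ v (star (a : MonotoneFock →L[ℂ] MonotoneFock) (a.1 v))
    rw [ContinuousLinearMap.star_eq_adjoint, ContinuousLinearMap.adjoint_inner_right,
      inner_self_eq_norm_sq_to_K]
    simpa only [Complex.coe_algebraMap, Complex.ofReal_pow] using
      Complex.zero_le_real.2 (sq_nonneg ‖a.1 v‖)
  map_one := by
    change inner ℂ v v = 1
    rw [inner_self_eq_norm_sq_to_K, hv]
    simp

theorem vectorState_apply (v : MonotoneFock) (hv : ‖v‖ = 1) (x : monotoneAlgebra) :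
    (vectorState v hv).toLinearMap x = inner ℂ v ((x : MonotoneFock →L[ℂ] MonotoneFock) v) := rfl

theorem norm_vectorState_apply_le (v : MonotoneFock) (hv : ‖v‖ = 1) (x : monotoneAlgebra) :
    ‖(vectorState v hv).toLinearMap x‖ ≤ ‖x‖ := by
  refine (norm_inner_le_norm (𝕜 := ℂ) v (x.1 v)).trans ?_
  rw [hv, one_mul]
  refine (ContinuousLinearMap.le_opNorm _ _).trans ?_
  rw [hv, mul_one]
  rfl

theorem vectorState_monotoneShift {v w : MonotoneFock} (hv : ‖v‖ = 1) (hw : ‖w‖ = 1)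
    (h : star (fockShift : MonotoneFock →L[ℂ] MonotoneFock) v = w) (x : monotoneAlgebra) :
    (vectorState v hv).toLinearMap (monotoneShift x) = (vectorState w hw).toLinearMap x := by
  subst h
  change inner ℂ v (Unitary.conjStarAlgAut ℂ (MonotoneFock →L[ℂ] MonotoneFock) fockShift x.1 v) = _
  rw [Unitary.conjStarAlgAut_apply, vectorState_apply, mul_apply_eq_comp, mul_apply_eq_comp]
  conv_rhs => rw [ContinuousLinearMap.star_eq_adjoint, ContinuousLinearMap.adjoint_inner_left]
  rfl

theorem vectorState_creatorElt_mul {v : MonotoneFock} (hv : ‖v‖ = 1) {i : ℤ}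
    (h : star (creator i) v = 0) (y : monotoneAlgebra) :
    (vectorState v hv).toLinearMap (creatorElt i * y) = 0 := by
  change inner ℂ v (creator i (y.1 v)) = 0
  rw [← ContinuousLinearMap.adjoint_inner_left, ← ContinuousLinearMap.star_eq_adjoint, h,
    inner_zero_left]

theorem vectorState_mul_annihilator {v : MonotoneFock} (hv : ‖v‖ = 1) {i : ℤ}
    (h : star (creator i) v = 0) (y : monotoneAlgebra) :
    (vectorState v hv).toLinearMap (y * star (creatorElt i)) = 0 := by
  change inner ℂ v (y.1 (star (creator i) v)) = 0
  rw [h, map_zero, inner_zero_right]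

theorem vectorState_range_projection_of_eq {v : MonotoneFock} (hv : ‖v‖ = 1) {i : ℤ}
    (h : (star (creator i) * creator i) v = v) :
    (vectorState v hv).toLinearMap (star (creatorElt i) * creatorElt i) = 1 := by
  rw [← (vectorState v hv).map_one]
  change inner ℂ v ((star (creator i) * creator i) v) = inner ℂ v v
  rw [h]

theorem vectorState_range_projection_of_eq_zero {v : MonotoneFock} (hv : ‖v‖ = 1) {i : ℤ}
    (h : (star (creator i) * creator i) v = 0) :
    (vectorState v hv).toLinearMap (star (creatorElt i) * creatorElt i) = 0 := by
  change inner ℂ v ((star (creator i) * creator i) v) = 0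
  rw [h, inner_zero_right]

/-- The vacuum state. -/
def vacuumState : AlgState monotoneAlgebra := vectorState vacuum norm_vacuum

/-- The vector state of the one-particle vector `e_n`. -/
def oneParticleState (n : ℤ) : AlgState monotoneAlgebra :=
  vectorState (oneParticle n) (norm_oneParticle n)

theorem vacuumState_isInvariant : vacuumState.IsInvariant monotoneShift :=
  vectorState_monotoneShift _ _ star_fockShift_vacuum

theorem oneParticleState_monotoneShift (n : ℤ) (x : monotoneAlgebra) :
    (oneParticleState n).toLinearMap (monotoneShift x) = (oneParticleState (n - 1)).toLinearMap x :=
  vectorState_monotoneShift _ _ (star_fockShift_oneParticle n) x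

theorem oneParticleState_range_projection (i n : ℤ) :
    (oneParticleState n).toLinearMap (star (creatorElt i) * creatorElt i) =
      if i < n then 1 else 0 := by
  have h := range_projection_oneParticle i n
  split_ifs at h ⊢
  · exact vectorState_range_projection_of_eq _ h
  · exact vectorState_range_projection_of_eq_zero _ h

/-- Once `n > i`, the vector `e_n` behaves like the vacuum: the annihilator of index `i` kills it
and the range projection fixes it. The two states then agree on the generating element. -/
theorem tendsto_oneParticleState_atTop (x : monotoneAlgebra) :
    Tendsto (fun n => (oneParticleState n).toLinearMap x) atTop
      (𝓝 (vacuumState.toLinearMap x)) := by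
  rw [← tendsto_sub_nhds_zero_iff]
  induction x using monotoneAlgebra_induction with
  | hclosed =>
    refine isClosed_setOf_tendsto_zero _ _ 2 fun n x y => ?_
    rw [sub_sub_sub_comm, ← map_sub, ← map_sub, two_mul]
    exact (norm_sub_le _ _).trans
      (add_le_add (norm_vectorState_apply_le _ _ _) (norm_vectorState_apply_le _ _ _))
  | add x y hx hy =>
    simpa only [map_add, add_sub_add_comm, add_zero] using hx.add hy
  | smul c x hx =>
    simpa only [map_smul, ← smul_sub, smul_zero] using hx.const_smul c
  | one => simp [AlgState.map_one]
  | proj i =>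
    refine tendsto_const_nhds.congr' ?_
    filter_upwards [eventually_gt_atTop i] with n hn
    rw [oneParticleState_range_projection, if_pos hn, vacuumState,
      vectorState_range_projection_of_eq _ (range_projection_vacuum i), sub_self]
  | creator_mul i y =>
    refine tendsto_const_nhds.congr' ?_
    filter_upwards [eventually_gt_atTop i] with n hn
    rw [oneParticleState, vectorState_creatorElt_mul _ (star_creator_oneParticle_of_ne hn.ne'),
      vacuumState, vectorState_creatorElt_mul _ (star_creator_vacuum i), sub_self]
  | mul_annihilator i y =>
    refine tendsto_const_nhds.congr' ?_
    filter_upwards [eventually_gt_atTop i] with n hn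
    rw [oneParticleState, vectorState_mul_annihilator _ (star_creator_oneParticle_of_ne hn.ne'),
      vacuumState, vectorState_mul_annihilator _ (star_creator_vacuum i), sub_self]

/-- On each generating element the values are eventually constant. The limit vanishes on every range
projection, so it is no vector state; the Cauchy property avoids having to name it beforehand. -/
theorem cauchySeq_oneParticleState_neg (x : monotoneAlgebra) :
    CauchySeq fun n : ℕ => (oneParticleState (-(n : ℤ))).toLinearMap x := by
  have hev : ∀ i : ℤ, ∀ᶠ p : ℕ × ℕ in atTop, -(p.1 : ℤ) < i ∧ -(p.2 : ℤ) < i := by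
    intro i
    filter_upwards [eventually_ge_atTop ((i.natAbs + 1, i.natAbs + 1) : ℕ × ℕ)] with p hp
    have h1 : i.natAbs + 1 ≤ p.1 := hp.1
    have h2 : i.natAbs + 1 ≤ p.2 := hp.2
    omega
  suffices h : Tendsto (fun p : ℕ × ℕ => (oneParticleState (-(p.1 : ℤ))).toLinearMap x -
      (oneParticleState (-(p.2 : ℤ))).toLinearMap x) atTop (𝓝 0) by
    rw [cauchySeq_iff_tendsto_dist_atTop_0]
    simpa only [dist_eq_norm, norm_zero] using h.norm
  induction x using monotoneAlgebra_induction with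
  | hclosed =>
    refine isClosed_setOf_tendsto_zero _ _ 2 fun n x y => ?_
    rw [sub_sub_sub_comm, ← map_sub, ← map_sub, two_mul]
    exact (norm_sub_le _ _).trans
      (add_le_add (norm_vectorState_apply_le _ _ _) (norm_vectorState_apply_le _ _ _))
  | add x y hx hy =>
    simpa only [map_add, add_sub_add_comm, add_zero] using hx.add hy
  | smul c x hx =>
    simpa only [map_smul, ← smul_sub, smul_zero] using hx.const_smul c
  | one => simp [AlgState.map_one]
  | proj i =>
    refine tendsto_const_nhds.congr' ?_
    filter_upwards [hev i] with p hp
    rw [oneParticleState_range_projection, oneParticleState_range_projection,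
      if_neg hp.1.not_gt, if_neg hp.2.not_gt, sub_self]
  | creator_mul i y =>
    refine tendsto_const_nhds.congr' ?_
    filter_upwards [hev i] with p hp
    rw [oneParticleState, vectorState_creatorElt_mul _ (star_creator_oneParticle_of_ne hp.1.ne),
      oneParticleState, vectorState_creatorElt_mul _ (star_creator_oneParticle_of_ne hp.2.ne),
      sub_self]
  | mul_annihilator i y =>
    refine tendsto_const_nhds.congr' ?_
    filter_upwards [hev i] with p hp
    rw [oneParticleState, vectorState_mul_annihilator _ (star_creator_oneParticle_of_ne hp.1.ne),
      oneParticleState, vectorState_mul_annihilator _ (star_creator_oneParticle_of_ne hp.2.ne),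
      sub_self]

/-! ### Failure of unique ergodicity -/

theorem AlgState.exists_of_tendsto {A : Type*} [Ring A] [StarRing A] [Algebra ℂ A]
    (φ : ℕ → AlgState A) (h : ∀ a, ∃ c, Tendsto (fun n => (φ n).toLinearMap a) atTop (𝓝 c)) :
    ∃ ψ : AlgState A, ∀ a,
      Tendsto (fun n => (φ n).toLinearMap a) atTop (𝓝 (ψ.toLinearMap a)) := by
  choose L hL using h
  refine ⟨⟨⟨⟨L, fun a b => ?_⟩, fun c a => ?_⟩, fun a => ?_, ?_⟩, hL⟩
  · refine tendsto_nhds_unique (hL (a + b)) ?_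
    simpa only [map_add] using (hL a).add (hL b)
  · refine tendsto_nhds_unique (hL (c • a)) ?_
    simpa only [map_smul, RingHom.id_apply] using (hL a).const_smul c
  · exact ge_of_tendsto' (hL (star a * a)) fun n => (φ n).nonneg a
  · refine tendsto_nhds_unique (hL 1) ?_
    simp only [AlgState.map_one, tendsto_const_nhds_iff]

theorem oneParticleState_eq_of_fixed {x : monotoneAlgebra} (hx : monotoneShift x = x) (n : ℤ) :
    (oneParticleState n).toLinearMap x = (oneParticleState 0).toLinearMap x := by
  have h : ∀ n : ℤ, (oneParticleState n).toLinearMap x =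
      (oneParticleState (n - 1)).toLinearMap x := fun n => by
    rw [← oneParticleState_monotoneShift, hx]
  induction n with
  | zero => rfl
  | succ n ih => rw [h, add_sub_cancel_right, ih]
  | pred n ih => rw [← h, ih]

/-- The restriction of a state to a unital ⋆-subalgebra. -/
def AlgState.restrict {A : Type*} [CStarAlgebra A] (φ : AlgState A) (S : StarSubalgebra ℂ A) :
    AlgState S where
  toLinearMap := φ.toLinearMap ∘ₗ S.subtype.toAlgHom.toLinearMap
  nonneg := fun a => φ.nonneg (a : A)
  map_one := φ.map_one

theorem not_uniquelyErgodicWrtFixedPoints_monotoneShift :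
    ¬ UniquelyErgodicWrtFixedPoints monotoneShift := by
  intro hue
  obtain ⟨φ, hφ⟩ := AlgState.exists_of_tendsto (fun n : ℕ => oneParticleState (-(n : ℤ)))
    fun x => cauchySeq_tendsto_of_complete (cauchySeq_oneParticleState_neg x)
  have hinv : φ.IsInvariant monotoneShift := by
    intro x
    refine tendsto_nhds_unique (hφ (monotoneShift x)) ?_
    -- The shift turns the state of `e_{-n}` into that of `e_{-(n+1)}`, which only reindexes the
    -- sequence.
    refine ((tendsto_add_atTop_iff_nat 1).2 (hφ x)).congr fun n => ?_
    rw [oneParticleState_monotoneShift, Nat.cast_add, Nat.cast_one, neg_add']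
  have hfix : ∀ x, monotoneShift x = x → φ.toLinearMap x = vacuumState.toLinearMap x := by
    intro x hx
    have h1 := hφ x
    have h2 := tendsto_oneParticleState_atTop x
    simp only [oneParticleState_eq_of_fixed hx] at h1 h2
    exact (tendsto_nhds_unique h1 tendsto_const_nhds).trans
      (tendsto_nhds_unique tendsto_const_nhds h2)
  have heq : φ = vacuumState :=
    (hue (vacuumState.restrict _)).unique ⟨hinv, fun a => hfix a a.2⟩
      ⟨vacuumState_isInvariant, fun _ => rfl⟩
  have h0 := hφ (star (creatorElt 0) * creatorElt 0)
  rw [heq, vacuumState, vectorState_range_projection_of_eq _ (range_projection_vacuum 0)] at h0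
  simp only [oneParticleState_range_projection] at h0
  have h1 : ∀ n : ℕ, (if (0 : ℤ) < -(n : ℤ) then (1 : ℂ) else 0) = 0 := fun n => if_neg (by omega)
  simp only [h1] at h0
  exact zero_ne_one (tendsto_nhds_unique tendsto_const_nhds h0)

/-! ### Divergence of the unweighted averages -/

/-- The `k`-th shift of the projection keeps `e_m` exactly when `k < m`, so `min n m` of the `n`
terms survive. -/
theorem ergodicAverage_range_projection_oneParticle (n : ℕ) (m : ℕ) :
    (ergodicAverage monotoneShift 1 n (star (creatorElt 0) * creatorElt 0)).1 (oneParticle m) =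
      ((n : ℂ)⁻¹ * (min n m : ℕ)) • oneParticle m := by
  have hterm : ∀ k : ℕ,
      (monotoneShift^[k] (star (creatorElt 0) * creatorElt 0)).1 (oneParticle m) =
        if k < m then oneParticle m else 0 := by
    intro k
    rw [iterate_map_mul, ← star_iterate_starAlgHom, iterate_monotoneShift_creatorElt, zero_add]
    have := range_projection_oneParticle k m
    simp only [Nat.cast_lt] at this
    exact this
  have hcoe : (ergodicAverage monotoneShift 1 n (star (creatorElt 0) * creatorElt 0)).1
      (oneParticle m) = (n : ℂ)⁻¹ • ∑ k ∈ Finset.range n,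
        (monotoneShift^[k] (star (creatorElt 0) * creatorElt 0)).1 (oneParticle m) := by
    simp [ergodicAverage]
  have hcard : (Finset.range n).filter (· < m) = Finset.range (min n m) := by
    ext k
    simp
  rw [hcoe, mul_smul]
  congr 1
  simp only [hterm]
  rw [← Finset.sum_filter, hcard, Finset.sum_const, Finset.card_range, Nat.cast_smul_eq_nsmul]

theorem not_tendsto_ergodicAverage_range_projection :
    ¬ ∃ y : monotoneAlgebra, Tendsto
      (fun n : ℕ => ergodicAverage monotoneShift 1 n (star (creatorElt 0) * creatorElt 0))
      atTop (𝓝 y) := by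
  rintro ⟨y, hy⟩
  have hy' := (continuous_subtype_val.tendsto y).comp hy
  -- For fixed `m` the coefficient is `m / n` once `n ≥ m`, so a norm limit must kill `e_m`.
  have hzero : ∀ m : ℕ, y.1 (oneParticle m) = 0 := by
    intro m
    have h1 := ((ContinuousLinearMap.apply ℂ MonotoneFock (oneParticle m)).continuous.tendsto
      y.1).comp hy'
    refine tendsto_nhds_unique h1 ?_
    have h2 : Tendsto (fun n : ℕ => ((m : ℂ) * (n : ℂ)⁻¹) • oneParticle m) atTop (𝓝 0) := by
      simpa using ((tendsto_inv_atTop_nhds_zero_nat (𝕜 := ℂ)).const_mul (m : ℂ)).smul_const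
        (oneParticle m)
    refine h2.congr' ?_
    filter_upwards [eventually_ge_atTop m] with n hn
    refine Eq.trans ?_ (ergodicAverage_range_projection_oneParticle n m).symm
    rw [min_eq_right hn, mul_comm]
  obtain ⟨N, hN⟩ := Metric.tendsto_atTop.1 hy' 1 one_pos
  -- The average of length `N + 1` fixes `e_{N+1}`, so its distance to `y` is at least `1`; the
  -- successor keeps the length nonzero.
  have h := hN (N + 1) (Nat.le_succ N)
  rw [dist_eq_norm] at h
  have h1 := ContinuousLinearMap.le_opNorm ((ergodicAverage monotoneShift 1 (N + 1)
    (star (creatorElt 0) * creatorElt 0)).1 - y.1) (oneParticle (N + 1 : ℕ))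
  have hne : ((N + 1 : ℕ) : ℂ) ≠ 0 := Nat.cast_ne_zero.2 (Nat.succ_ne_zero N)
  rw [sub_apply, ergodicAverage_range_projection_oneParticle, hzero, sub_zero,
    min_self, inv_mul_cancel₀ hne, one_smul, norm_oneParticle, mul_one] at h1
  exact absurd h (not_lt.2 h1)

theorem mainTheorem7 :
    (∀ z : ℂ, ‖z‖ = 1 → z ≠ 1 → ∀ x : monotoneAlgebra,
      Tendsto (fun n : ℕ => ergodicAverage monotoneShift z n x) atTop (𝓝 0)) ∧
    fullPeripheralPointSpectrum monotoneShift = {1} ∧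
    ¬ UniquelyErgodicWrtFixedPoints monotoneShift ∧
    (∃ x : monotoneAlgebra, ¬ ∃ y : monotoneAlgebra,
      Tendsto (fun n : ℕ => ergodicAverage monotoneShift 1 n x) atTop (𝓝 y)) := by
  refine ⟨fun z hz hz1 x => tendsto_ergodicAverage_monotoneShift hz hz1 x, ?_,
    not_uniquelyErgodicWrtFixedPoints_monotoneShift,
    _, not_tendsto_ergodicAverage_range_projection⟩
  refine Set.eq_singleton_iff_unique_mem.2 ⟨⟨norm_one, vacuumState, vacuumState_isInvariant,
    hasEigenvalue_covariantIsometry_one _ _ _⟩, ?_⟩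
  rintro z ⟨hz, φ, h, hev⟩
  by_contra hz1
  exact not_hasEigenvalue_of_tendsto_ergodicAverage hz
    (tendsto_ergodicAverage_monotoneShift hz hz1) φ h hev

end
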